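/- Let $d,n\ge 0$ be integers and let $H_d$ be the set of real univariate polynomials of degree at most $d$, where $f\in H_d$ labels $x\in\mathbb R$ by $\operatorname{sign} f(x)\in\{\pm1\}$, with $\operatorname{sign}(0)=1$. Given a sample $S$ of $n$ real points, a learner may adaptively query labels of points of $S$ and has to output the labels of all points of $S$. The Sample-and-Search algorithm (for $d$) queries the points of $S$ one at a time in a uniformly random order (without replacement) until either all points have been queried, or $d$ sign flips have been seen, i.e. there are queried points $x_0<x_1<\dots<x_d$ such that consecutive ones have different labels. In the second case it performs a binary search for a sign change among the points of $S$ between $x_{j-1}$ and $x_j$ for each $j=1,\dots,d$. It then outputs the labels so determined. For $d\ge1$ and $\alpha>0$, the symmetric Dirichlet distribution $\mathrm{Dir}(\alpha)$ of order $d+1$ is the law on $\{y\in\mathbb R^{d+1}:y_i\ge 0,\ \sum_i y_i=1\}$ with density $\frac{\Gamma((d+1)\alpha)}{\Gamma(\alpha)^{d+1}}\prod_{i=1}^{d+1}y_i^{\alpha-1}$ (with respect to Lebesgue measure in the first $d$ coordinates). Let $S$ consist of $n$ independent uniform points of $[0,1]$, and let, independently, $f=a\prod_{k=1}^d (x-r_k)$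 with $r_k=y_1+\dots+y_k$ and $y\sim \mathrm{Dir}(\alpha)$, where $a\ne0$ is any fixed real number. Let $q_{d,\alpha,a}(n)$ be the expected number of label queries of Sample-and-Search, the expectation being over $S$, $f$ and the random order. **Theorem.** Sample-and-Search learns perfectly: for every $d\ge 0$, every finite sample $S\subset\mathbb R$, every $f\in H_d$ and every outcome of its internal randomness, it outputs the correct labels of all points of $S$. Moreover: 1. There is a universal constant $C$ such that $q_{d,1,a}(n)\le C\,d^2\log d\,\log n$ for all $d\ge2$, $n\ge2$ and $a\neq 0$. 2. There is a universal constant $C$ such that $q_{d,\alpha,a}(n)\le C\,(d^2\log d+d\log n)$ for all real $\alpha\ge2$ and all $d\ge1$, $n\ge2$ and $a\neq 0$. 3. For every $c>0$ there is a constant $C$, depending only on $c$, such that $q_{d,\alpha,a}(n)\le C\,d\log n$ for all $d\ge1$, $n\ge2$, $a\neq 0$ and all real $\alpha\ge c\log^2 n$. (In particular this holds when $\alpha\ge d\log^2 n$.) -/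

import Mathlib

noncomputable section

namespace PTF

/-- A deterministic adaptive query algorithm: a decision tree which asks binary queries indexed
by `ι` and finally outputs an element of `β`. -/
inductive QueryTree (ι β : Type) : Type
  | ret (out : β) : QueryTree ι β
  | ask (i : ι) (next : Bool → QueryTree ι β) : QueryTree ι β

namespace QueryTree

/-- The output of the algorithm when query `i` is answered by `ℓ i`. -/
def run {ι β : Type} (ℓ : ι → Bool) : QueryTree ι β → β
  | ret out => out
  | ask i next => run ℓ (next (ℓ i))

/-- The number of queries made when query `i` is answered by `ℓ i`. -/
def cost {ι β : Type} (ℓ : ι → Bool) : QueryTree ι β → ℕ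
  | ret _ => 0
  | ask i next => cost ℓ (next (ℓ i)) + 1

/-- Sequential composition. -/
def bind {ι β γ : Type} : QueryTree ι β → (β → QueryTree ι γ) → QueryTree ι γ
  | ret out, F => F out
  | ask i next, F => ask i (fun b => bind (next b) F)

/-- Run `T` for every element of a list, one after the other, and collect the outputs. -/
def forList {ι κ β : Type} (T : κ → QueryTree ι β) : List κ → QueryTree ι (List β)
  | [] => ret []
  | k :: ks => (T k).bind (fun b => (forList T ks).bind (fun bs => ret (b :: bs)))

/-- Rename the queries by `e`. -/
def mapQuery {ι κ β : Type} (e : ι → κ) : QueryTree ι β → QueryTree κ β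
  | ret out => ret out
  | ask i next => ask (e i) (fun b => mapQuery e (next b))

end QueryTree

/-- The label `sign (f x)` of `x`, with `true` for `1` and `false` for `-1`, and `sign 0 = 1`. -/
def label (f : Polynomial ℝ) (x : ℝ) : Bool := decide (0 ≤ f.eval x)

/-- The labels of all points of a sample. -/
def labels {n : ℕ} (f : Polynomial ℝ) (S : Fin n → ℝ) : Fin n → Bool := fun i => label f (S i)

/-- A randomized learner with label queries. For every size `n` and every unlabeled sample
`S : Fin n → ℝ` it chooses at random (by its internal randomness) a decision tree that may query
the labels of the points `S i`, and that outputs a labeling of the whole sample. -/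
abbrev Learner : Type :=
  (n : ℕ) → (Fin n → ℝ) → PMF (QueryTree (Fin n) (Fin n → Bool))

/-- Zero error: whatever the sample, the polynomial `f` of degree at most `d` and the internal
randomness, the learner labels all points of the sample correctly. -/
def PerfectlyLearns (d : ℕ) (A : Learner) : Prop :=
  ∀ (n : ℕ) (S : Fin n → ℝ) (f : Polynomial ℝ), f.natDegree ≤ d →
    ∀ T ∈ (A n S).support, T.run (labels f S) = labels f S

/-- The expected number of queries, over the internal randomness only. -/
def meanCost (A : Learner) {n : ℕ} (S : Fin n → ℝ) (f : Polynomial ℝ) : ENNReal :=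
  ∑' T : QueryTree (Fin n) (Fin n → Bool), A n S T * (T.cost (labels f S) : ENNReal)

/-! ### Sample and Search

Below, `Fin n` enumerates the sample in increasing order, and `known` records the labels that have
been queried so far. -/

/-- The points `p 0 < p 1 < … < p d` have been queried, and consecutive ones have different
labels. -/
def IsAlternating {n : ℕ} (d : ℕ) (known : Fin n → Option Bool) (p : Fin (d + 1) → Fin n) : Prop :=
  StrictMono p ∧ (∀ j, known (p j) ≠ none) ∧
    ∀ j : Fin d, known (p j.castSucc) ≠ known (p j.succ)

/-- At least `d` sign flips have been seen in the queried points. -/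
def SeesFlips {n : ℕ} (d : ℕ) (known : Fin n → Option Bool) : Prop :=
  ∃ p : Fin (d + 1) → Fin n, IsAlternating d known p

/-- Binary search between `lo`, whose label is `b`, and `hi`, whose label is not `b`: it returns
a point with label `b` whose successor does not have label `b`. -/
def binarySearch {n : ℕ} (b : Bool) (lo hi : Fin n) : QueryTree (Fin n) (Fin n) :=
  if h : (hi : ℕ) ≤ (lo : ℕ) + 1 then QueryTree.ret lo
  else
    QueryTree.ask ⟨((lo : ℕ) + hi) / 2, by omega⟩ (fun c =>
      if c = b then binarySearch b ⟨((lo : ℕ) + hi) / 2, by omega⟩ hi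
      else binarySearch b lo ⟨((lo : ℕ) + hi) / 2, by omega⟩)
termination_by (hi : ℕ) - (lo : ℕ)
decreasing_by all_goals omega

/-- The search phase: a binary search in each of the `d` intervals from `p j` to `p (j + 1)`. The
sign flips right after each of the points found, and nowhere else, which determines the labels. -/
def searchPhase {n : ℕ} (d : ℕ) (known : Fin n → Option Bool) (p : Fin (d + 1) → Fin n) :
    QueryTree (Fin n) (Fin n → Bool) :=
  (QueryTree.forList
      (fun j : Fin d =>
        binarySearch ((known (p j.castSucc)).getD true) (p j.castSucc) (p j.succ))
      (List.finRange d)).bind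
    (fun ts => QueryTree.ret (fun q =>
      ((known (p 0)).getD true) ^^ decide (Odd (ts.countP (fun t => decide (t < q))))))

open Classical in
/-- Query the points in the order of the given list, until `d` sign flips have been seen (then
proceed to the search phase) or the list is exhausted (then output the labels that were queried). -/
def sampleThenSearch {n : ℕ} (d : ℕ) :
    List (Fin n) → (Fin n → Option Bool) → QueryTree (Fin n) (Fin n → Bool)
  | [], known =>
      if h : SeesFlips d known then searchPhase d known h.choose
      else QueryTree.ret (fun q => (known q).getD true)
  | q :: rest, known =>
      if h : SeesFlips d known then searchPhase d known h.choose
      else QueryTree.ask q (fun b =>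
        sampleThenSearch d rest (Function.update known q (some b)))

/-- Sample and Search on the sample `S`, where the points are queried in the order `σ`, a
permutation of the positions in the sorted sample. The points of the sorted sample are
`S (Tuple.sort S 0) ≤ S (Tuple.sort S 1) ≤ …`. -/
def sampleAndSearchTree (d : ℕ) {n : ℕ} (S : Fin n → ℝ) (σ : Equiv.Perm (Fin n)) :
    QueryTree (Fin n) (Fin n → Bool) :=
  ((sampleThenSearch d ((List.finRange n).map σ) (fun _ => none)).mapQuery (Tuple.sort S)).bind
    (fun out => QueryTree.ret (fun i => out ((Tuple.sort S).symm i)))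

/-- The Sample and Search algorithm: points are queried uniformly at random without
replacement, that is, in a uniformly random order. -/
def sampleAndSearch (d : ℕ) : Learner := fun n S =>
  (PMF.uniformOfFintype (Equiv.Perm (Fin n))).map (sampleAndSearchTree d S)

/-! ### The distributions -/

/-- `n` independent points, uniform on `[0, 1]`. -/
def uniformSample (n : ℕ) : MeasureTheory.Measure (Fin n → ℝ) :=
  MeasureTheory.Measure.pi (fun _ => MeasureTheory.volume.restrict (Set.Icc (0 : ℝ) 1))

/-- The density of the first `d` coordinates of the symmetric Dirichlet distribution of order
`d + 1` with parameter `α`; the last coordinate is `1 - ∑ i, x i`. -/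
def dirichletPDF (d : ℕ) (α : ℝ) (x : Fin d → ℝ) : ENNReal :=
  open Classical in
  if (∀ i, 0 ≤ x i) ∧ ∑ i, x i ≤ 1 then
    ENNReal.ofReal
      (Real.Gamma ((d + 1) * α) / Real.Gamma α ^ (d + 1) *
        ((∏ i, x i ^ (α - 1)) * (1 - ∑ i, x i) ^ (α - 1)))
  else 0

/-- The symmetric Dirichlet distribution `Dir(α)` of order `d + 1`, on the standard simplex. -/
def dirichlet (d : ℕ) (α : ℝ) : MeasureTheory.Measure (Fin (d + 1) → ℝ) :=
  (MeasureTheory.volume.withDensity (dirichletPDF d α)).map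
    (fun x => Fin.snoc (α := fun _ => ℝ) x (1 - ∑ i, x i))

/-- The `k`-th root when the spacings between `0`, the successive roots, and `1` are
`y 0, …, y d`. -/
def rootOfSpacings {d : ℕ} (y : Fin (d + 1) → ℝ) (k : Fin d) : ℝ :=
  ∑ j ∈ Finset.Iic k.castSucc, y j

/-- The polynomial with leading coefficient `a` and spacings `y`. -/
def polyOfSpacings {d : ℕ} (a : ℝ) (y : Fin (d + 1) → ℝ) : Polynomial ℝ :=
  Polynomial.C a * ∏ k : Fin d, (Polynomial.X - Polynomial.C (rootOfSpacings y k))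

/-- The expected number of queries of the learner `A` on a sample of `n` independent uniform points
of `[0, 1]` and an independent polynomial with leading coefficient `a` and `d` roots in `[0, 1]`
whose spacings have law `Dir(α)`: the expectation is over the sample, the roots and the internal
randomness. -/
def expectedQueries (A : Learner) (d n : ℕ) (α a : ℝ) : ENNReal :=
  ∫⁻ z, meanCost A z.1 (polyOfSpacings a z.2) ∂((uniformSample n).prod (dirichlet d α))

end PTF

end

/-! Correctness: on the sorted sample the labels flip at most `d` times (`card_flips_label_le`).
Once `d` flips have been seen, each of the `d` disjoint search intervals contains a flip, hence
exactly one, so binary search finds all flips and their parity gives every label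
(`run_searchPhase`).

Cost: the searches take at most `d * Nat.clog 2 n` queries. Sampling stops as soon as every one of
the `d + 1` gaps between consecutive roots contains a queried point (`seesFlips_of_forall_gap`), so
its expected length is at most the sum over `t` of the probability that the first `t` points miss
some gap. For given spacings `y`, gap `i` is missed with probability `(1 - y i) ^ t`. Each spacing
is Beta(α, dα), so the mean of this is the product `spacingMoment d α t`, and a union bound gives
`expectedQueries_le`.

It remains to sum `min 1 ((d + 1) * spacingMoment d α t)`. For `α = 1` the moment is `d / (d + t)`
and the sum is harmonic. For `α ≥ 2` the moments are at most those for `α = 2`, whose sum telescopes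
to order `d ^ 2`. For `α ≥ 6 log n` and `d < n` they fall to `n ^ (-2)` within about `6 d log n`
steps. -/

noncomputable section

namespace PTF

/-! ### Outputs and costs of composed decision trees -/

namespace QueryTree

variable {ι κ β γ : Type}

theorem run_bind (ℓ : ι → Bool) (T : QueryTree ι β) (F : β → QueryTree ι γ) :
    (T.bind F).run ℓ = (F (T.run ℓ)).run ℓ := by
  induction T with
  | ret out => rfl
  | ask i next ih => simp only [bind, run, ih]

theorem cost_bind (ℓ : ι → Bool) (T : QueryTree ι β) (F : β → QueryTree ι γ) :
    (T.bind F).cost ℓ = T.cost ℓ + (F (T.run ℓ)).cost ℓ := by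
  induction T with
  | ret out => simp [bind, run, cost]
  | ask i next ih => simp only [bind, run, cost, ih]; omega

theorem run_mapQuery (e : ι → κ) (ℓ : κ → Bool) (T : QueryTree ι β) :
    (T.mapQuery e).run ℓ = T.run (ℓ ∘ e) := by
  induction T with
  | ret out => rfl
  | ask i next ih => simp only [mapQuery, run, ih, Function.comp]

theorem cost_mapQuery (e : ι → κ) (ℓ : κ → Bool) (T : QueryTree ι β) :
    (T.mapQuery e).cost ℓ = T.cost (ℓ ∘ e) := by
  induction T with
  | ret out => rfl
  | ask i next ih => simp only [mapQuery, cost, ih, Function.comp]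

theorem run_forList (ℓ : ι → Bool) (T : κ → QueryTree ι β) (ks : List κ) :
    (forList T ks).run ℓ = ks.map fun k => (T k).run ℓ := by
  induction ks with
  | nil => rfl
  | cons k ks ih => simp [forList, run_bind, ih, run]

theorem cost_forList (ℓ : ι → Bool) (T : κ → QueryTree ι β) (ks : List κ) :
    (forList T ks).cost ℓ = (ks.map fun k => (T k).cost ℓ).sum := by
  induction ks with
  | nil => rfl
  | cons k ks ih => simp [forList, cost_bind, ih, cost]

end QueryTree

/-! ### Sign flips and binary search -/

/-- The positions after which the labeling `ℓ` changes. -/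
def flips {n : ℕ} (ℓ : Fin n → Bool) : Finset (Fin n) :=
  open Classical in
  Finset.univ.filter fun s => ∃ t : Fin n, (t : ℕ) = s + 1 ∧ ℓ s ≠ ℓ t

theorem mem_flips {n : ℕ} {ℓ : Fin n → Bool} {s : Fin n} :
    s ∈ flips ℓ ↔ ∃ t : Fin n, (t : ℕ) = s + 1 ∧ ℓ s ≠ ℓ t := by
  simp [flips]

/-- Induction on `q`: one step to the right toggles the label exactly when it adds a flip to the
count. -/
theorem label_eq_xor_odd_flips {n : ℕ} (ℓ : Fin n → Bool) (p q : Fin n) (hpq : p ≤ q) :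
    ℓ q = (ℓ p ^^ decide (Odd ((flips ℓ).filter fun s => p ≤ s ∧ s < q).card)) := by
  obtain ⟨q, hq⟩ := q
  have hp : (p : ℕ) ≤ q := hpq
  clear hpq
  induction q, hp using Nat.le_induction with
  | base =>
    rw [Finset.filter_false_of_mem]
    · simp
    · intro s _ h
      exact absurd (h.1.trans_lt h.2) (lt_irrefl _)
  | succ q hpq ih =>
    have hq' : q < n := by omega
    specialize ih hq'
    set A := (flips ℓ).filter fun s => p ≤ s ∧ s < (⟨q, hq'⟩ : Fin n) with hA
    have hnot : (⟨q, hq'⟩ : Fin n) ∉ A := by simp [hA]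
    by_cases h : ℓ ⟨q, hq'⟩ = ℓ ⟨q + 1, hq⟩
    · have : ((flips ℓ).filter fun s => p ≤ s ∧ s < (⟨q + 1, hq⟩ : Fin n)) = A := by
        refine Finset.filter_congr fun s hs => ?_
        obtain ⟨t, ht, hne⟩ := mem_flips.1 hs
        have : (s : ℕ) ≠ q := by
          rintro rfl
          exact hne (h.trans (congrArg ℓ (Fin.ext ht.symm)))
        simp only [Fin.lt_def, Fin.le_def]
        omega
      rw [this, ← h, ih]
    · have : ((flips ℓ).filter fun s => p ≤ s ∧ s < (⟨q + 1, hq⟩ : Fin n))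
          = insert ⟨q, hq'⟩ A := by
        ext s
        simp only [hA, Finset.mem_filter, Finset.mem_insert, Fin.lt_def, Fin.le_def, Fin.ext_iff]
        constructor
        · rintro ⟨h1, h2, h3⟩
          by_cases hs : (s : ℕ) = q
          · exact Or.inl hs
          · exact Or.inr ⟨h1, h2, by omega⟩
        · rintro (hs | ⟨h1, h2, h3⟩)
          · refine ⟨mem_flips.2 ⟨⟨q + 1, hq⟩, by simp [hs], ?_⟩, by omega, by omega⟩
            rwa [show s = ⟨q, hq'⟩ from Fin.ext hs]
          · exact ⟨h1, h2, by omega⟩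
      rw [this, Finset.card_insert_of_notMem hnot]
      have h2 : ℓ ⟨q + 1, hq⟩ = !ℓ ⟨q, hq'⟩ := by
        revert h; cases ℓ ⟨q, hq'⟩ <;> cases ℓ ⟨q + 1, hq⟩ <;> simp
      have h3 : decide (Odd (A.card + 1)) = !decide (Odd A.card) := by
        rw [← decide_not]; exact decide_eq_decide.2 Nat.odd_add_one
      rw [h2, ih, h3, Bool.xor_not]

/-- The invariant is that `lo` has label `b` and `hi` does not; when they become adjacent, `lo` is a
flip. -/
theorem run_binarySearch {n : ℕ} (ℓ : Fin n → Bool) (b : Bool) (lo hi : Fin n)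
    (hlt : lo < hi) (hlo : ℓ lo = b) (hhi : ℓ hi ≠ b) :
    lo ≤ (binarySearch b lo hi).run ℓ ∧ (binarySearch b lo hi).run ℓ < hi ∧
      (binarySearch b lo hi).run ℓ ∈ flips ℓ := by
  fun_induction binarySearch b lo hi with
  | case1 lo hi h =>
    have hlt' : (lo : ℕ) < hi := hlt
    simp only [QueryTree.run]
    refine ⟨le_rfl, hlt, mem_flips.2 ⟨hi, by omega, ?_⟩⟩
    rw [hlo]; exact hhi.symm
  | case2 lo hi h ih1 ih2 =>
    simp only [QueryTree.run]
    split_ifs with hc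
    · obtain ⟨h1, h2, h3⟩ := ih1 (Fin.lt_def.2 (by simp; omega)) hc hhi
      refine ⟨le_trans (Fin.le_def.2 (by simp; omega)) h1, h2, h3⟩
    · obtain ⟨h1, h2, h3⟩ := ih2 (Fin.lt_def.2 (by simp; omega)) hlo hc
      refine ⟨h1, h2.trans (Fin.lt_def.2 (by simp; omega)), h3⟩

theorem cost_binarySearch_le {n : ℕ} (ℓ : Fin n → Bool) (b : Bool) (lo hi : Fin n) :
    (binarySearch b lo hi).cost ℓ ≤ Nat.clog 2 (hi - lo) := by
  fun_induction binarySearch b lo hi with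
  | case1 lo hi h => simp [QueryTree.cost]
  | case2 lo hi h ih1 ih2 =>
    -- Either half of an interval of length `m` has length at most `⌈m / 2⌉`, and `clog` drops by
    -- exactly one there.
    have key : Nat.clog 2 ((hi : ℕ) - lo) = Nat.clog 2 (((hi : ℕ) - lo + 1) / 2) + 1 := by
      rw [Nat.clog_of_one_lt one_lt_two (by omega)]
      rfl
    simp only [QueryTree.cost]
    rw [key]
    split_ifs with hc
    · refine Nat.add_le_add_right (ih1.trans (Nat.clog_mono_right _ ?_)) 1
      simp; omega
    · refine Nat.add_le_add_right (ih2.trans (Nat.clog_mono_right _ ?_)) 1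
      simp; omega

/-! ### Correctness and cost of the two phases -/

/-- Everything that `known` records agrees with the labels `ℓ`. -/
def Consistent {n : ℕ} (ℓ : Fin n → Bool) (known : Fin n → Option Bool) : Prop :=
  ∀ q, known q ≠ none → known q = some (ℓ q)

theorem Consistent.update {n : ℕ} {ℓ : Fin n → Bool} {known : Fin n → Option Bool}
    (h : Consistent ℓ known) (q : Fin n) :
    Consistent ℓ (Function.update known q (some (ℓ q))) := by
  intro r hr
  by_cases hrq : r = q
  · subst hrq; simp
  · rw [Function.update_of_ne hrq] at hr ⊢
    exact h r hr

/-- Pigeonhole: the searches return `d` distinct flips and there are at most `d`, so they return all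
of them. The label of `p 0` and the parity of the flips to the left of a point then determine its
label. -/
theorem run_searchPhase {n d : ℕ} {ℓ : Fin n → Bool} {known : Fin n → Option Bool}
    (hk : Consistent ℓ known) (hflips : (flips ℓ).card ≤ d) {p : Fin (d + 1) → Fin n}
    (hp : IsAlternating d known p) : (searchPhase d known p).run ℓ = ℓ := by
  obtain ⟨hmono, hdef, halt⟩ := hp
  have hkp : ∀ j, known (p j) = some (ℓ (p j)) := fun j => hk _ (hdef j)
  have hne : ∀ j : Fin d, ℓ (p j.succ) ≠ ℓ (p j.castSucc) := by
    intro j h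
    apply halt j
    rw [hkp, hkp, h]
  simp only [searchPhase, QueryTree.run_bind, QueryTree.run_forList, QueryTree.run, hkp,
    Option.getD_some]
  set t : Fin d → Fin n := fun j =>
    (binarySearch (ℓ (p j.castSucc)) (p j.castSucc) (p j.succ)).run ℓ with ht
  have hspec : ∀ j : Fin d, p j.castSucc ≤ t j ∧ t j < p j.succ ∧ t j ∈ flips ℓ := fun j =>
    run_binarySearch ℓ _ _ _ (hmono (Fin.castSucc_lt_succ)) rfl (hne j)
  have hinj : StrictMono t := by
    intro i j hij
    refine (hspec i).2.1.trans_le (le_trans (hmono.monotone ?_) (hspec j).1)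
    rw [Fin.le_def]; simpa using hij
  have himg : Finset.univ.image t = flips ℓ := by
    refine Finset.eq_of_subset_of_card_le ?_ ?_
    · intro s hs
      obtain ⟨j, -, rfl⟩ := Finset.mem_image.1 hs
      exact (hspec j).2.2
    · rw [Finset.card_image_of_injective _ hinj.injective]
      simpa using hflips
  have hge : ∀ s ∈ flips ℓ, p 0 ≤ s := by
    intro s hs
    rw [← himg] at hs
    obtain ⟨j, -, rfl⟩ := Finset.mem_image.1 hs
    exact (hmono.monotone (Fin.zero_le _)).trans (hspec j).1
  have hcount : ∀ q : Fin n, ((List.finRange d).map t).countP (fun s => decide (s < q))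
      = ((flips ℓ).filter fun s => s < q).card := by
    intro q
    rw [← himg, Finset.filter_image, Finset.card_image_of_injective _ hinj.injective,
      List.countP_map, List.countP_eq_length_filter,
      ← List.toFinset_card_of_nodup ((List.nodup_finRange d).filter _)]
    congr 1
    ext j
    simp
  funext q
  rw [hcount]
  -- No flip lies to the left of `p 0`, so labels are constant up to `p 0`.
  rcases le_total (p 0) q with h | h
  · rw [label_eq_xor_odd_flips ℓ (p 0) q h]
    congr 4
    exact Finset.filter_congr fun s hs => by simp [hge s hs]
  · rw [label_eq_xor_odd_flips ℓ q (p 0) h, Finset.filter_false_of_mem,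
      Finset.filter_false_of_mem]
    · simp
    · intro s hs hsq
      exact absurd (hge s hs) (not_le.2 (hsq.trans_le h))
    · intro s hs hsq
      exact absurd (hge s hs) (not_le.2 hsq.2)

theorem cost_searchPhase_le {n d : ℕ} (ℓ : Fin n → Bool) (known : Fin n → Option Bool)
    (p : Fin (d + 1) → Fin n) : (searchPhase d known p).cost ℓ ≤ d * Nat.clog 2 n := by
  simp only [searchPhase, QueryTree.cost_bind, QueryTree.cost_forList, QueryTree.cost, add_zero]
  refine (List.sum_le_card_nsmul _ (Nat.clog 2 n) ?_).trans (by simp)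
  intro x hx
  obtain ⟨j, -, rfl⟩ := List.mem_map.1 hx
  exact (cost_binarySearch_le _ _ _ _).trans (Nat.clog_mono_right _ (by omega))

theorem run_sampleThenSearch {n d : ℕ} {ℓ : Fin n → Bool} (hflips : (flips ℓ).card ≤ d)
    (L : List (Fin n)) (known : Fin n → Option Bool) (hk : Consistent ℓ known)
    (hall : ∀ q, known q ≠ none ∨ q ∈ L) : (sampleThenSearch d L known).run ℓ = ℓ := by
  induction L generalizing known with
  | nil =>
    rw [sampleThenSearch]
    split_ifs with h
    · exact run_searchPhase hk hflips h.choose_spec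
    -- Every point is recorded by now, so the default `true` is never output.
    · funext q
      have := hk q (by simpa using hall q)
      simp [QueryTree.run, this]
  | cons q L ih =>
    rw [sampleThenSearch]
    split_ifs with h
    · exact run_searchPhase hk hflips h.choose_spec
    · refine ih _ (hk.update q) fun r => ?_
      by_cases hr : r = q
      · subst hr; simp
      · rw [Function.update_of_ne hr]
        simpa [hr] using hall r

/-- The record after the labels of the points in the list have been queried. -/
def recordLabels {n : ℕ} (ℓ : Fin n → Bool) (L : List (Fin n)) (known : Fin n → Option Bool) :
    Fin n → Option Bool :=
  L.foldl (fun k q => Function.update k q (some (ℓ q))) known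

theorem recordLabels_of_eq {n : ℕ} (ℓ : Fin n → Bool) (L : List (Fin n))
    (known : Fin n → Option Bool) (q : Fin n) (h : known q = some (ℓ q)) :
    recordLabels ℓ L known q = some (ℓ q) := by
  induction L generalizing known with
  | nil => exact h
  | cons r L ih =>
    refine ih _ ?_
    change Function.update known r (some (ℓ r)) q = _
    by_cases hr : q = r
    · subst hr; simp
    · rwa [Function.update_of_ne hr]

theorem recordLabels_of_mem {n : ℕ} (ℓ : Fin n → Bool) (L : List (Fin n))
    (known : Fin n → Option Bool) (q : Fin n) (h : q ∈ L) :
    recordLabels ℓ L known q = some (ℓ q) := by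
  induction L generalizing known with
  | nil => simp at h
  | cons r L ih =>
    rcases List.mem_cons.1 h with rfl | h
    · exact recordLabels_of_eq ℓ L _ q (Function.update_self ..)
    · exact ih _ h

-- Query number `t` is charged to the event that the first `t` labels do not yet show `d` flips.
-- Writing the bound as a sum of indicators avoids a stopping time and can be integrated term by
-- term.
open Classical in
theorem cost_sampleThenSearch_le {n d : ℕ} (ℓ : Fin n → Bool) (L : List (Fin n))
    (known : Fin n → Option Bool) :
    (sampleThenSearch d L known).cost ℓ ≤
      (∑ t ∈ Finset.range L.length,
        if SeesFlips d (recordLabels ℓ (L.take t) known) then 0 else 1) + d * Nat.clog 2 n := by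
  induction L generalizing known with
  | nil =>
    rw [sampleThenSearch]
    split_ifs with h
    · simpa using cost_searchPhase_le _ _ _
    · simp [QueryTree.cost]
  | cons q L ih =>
    rw [sampleThenSearch]
    split_ifs with h
    · exact (cost_searchPhase_le _ _ _).trans (Nat.le_add_left _ _)
    · simp only [QueryTree.cost]
      refine (Nat.add_le_add_right (ih _) 1).trans (le_of_eq ?_)
      rw [List.length_cons, Finset.sum_range_succ']
      have : ¬ SeesFlips d (recordLabels ℓ ((q :: L).take 0) known) := h
      rw [if_neg this]
      have e : ∀ t, recordLabels ℓ ((q :: L).take (t + 1)) known =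
          recordLabels ℓ (L.take t) (Function.update known q (some (ℓ q))) := fun t => rfl
      simp only [e]
      ring


/-! ### Dirichlet integrals and the law of one spacing -/

open MeasureTheory Set

/-- The unnormalized density of the Dirichlet distribution with `d` parameters equal to `a`, and
the last parameter equal to `b`. -/
def dirichletWeight (d : ℕ) (a b : ℝ) (x : Fin d → ℝ) : ENNReal :=
  open Classical in
  if (∀ i, 0 ≤ x i) ∧ ∑ i, x i ≤ 1 then
    ENNReal.ofReal ((∏ i, x i ^ (a - 1)) * (1 - ∑ i, x i) ^ (b - 1))
  else 0

theorem measurable_dirichletWeight (d : ℕ) (a b : ℝ) : Measurable (dirichletWeight d a b) := by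
  classical
  refine Measurable.ite ?_ (by fun_prop) measurable_const
  refine MeasurableSet.inter (s₁ := {x : Fin d → ℝ | ∀ i, 0 ≤ x i})
    (s₂ := {x : Fin d → ℝ | ∑ i, x i ≤ 1}) ?_ ?_
  · rw [ofPred_forall]
    exact MeasurableSet.iInter fun i => measurableSet_le measurable_const (measurable_pi_apply i)
  · exact measurableSet_le (by fun_prop) measurable_const

theorem lintegral_pi_eq_smul (d : ℕ) {c : ℝ} (hc : 0 < c) (f : (Fin d → ℝ) → ENNReal) :
    ∫⁻ x, f x = ENNReal.ofReal (c ^ d) * ∫⁻ z, f (c • z) := by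
  have h1 : ∫⁻ z, f (c • z) = ENNReal.ofReal (c ^ d)⁻¹ * ∫⁻ x, f x := by
    rw [← (measurableEmbedding_const_smul₀ hc.ne').lintegral_map (μ := volume) f,
      Measure.map_addHaar_smul volume hc.ne', lintegral_smul_measure, Module.finrank_fin_fun,
      abs_of_pos (by positivity), smul_eq_mul]
  rw [h1, ← mul_assoc, ← ENNReal.ofReal_mul (by positivity), mul_inv_cancel₀ (by positivity)]
  simp

/-- Stick breaking: once one coordinate is `u`, the others are `1 - u` times a point of the smaller
simplex, and the weight factors. -/
theorem dirichletWeight_insertNth_smul {d : ℕ} (a b : ℝ) (i : Fin (d + 1)) {u : ℝ}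
    (hu : u ∈ Ioo (0 : ℝ) 1) (z : Fin d → ℝ) :
    dirichletWeight (d + 1) a b (i.insertNth (α := fun _ => ℝ) u ((1 - u) • z)) =
      ENNReal.ofReal (u ^ (a - 1) * ((1 - u) ^ (a - 1)) ^ d * (1 - u) ^ (b - 1)) *
        dirichletWeight d a b z := by
  have hc : 0 < 1 - u := by linarith [hu.2]
  have hsum : ∑ j, (i.insertNth (α := fun _ => ℝ) u ((1 - u) • z) : Fin (d + 1) → ℝ) j
      = u + (1 - u) * ∑ j, z j := by
    rw [Fin.sum_univ_succAbove _ i]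
    simp [Finset.mul_sum]
  have hprod : ∏ j, (i.insertNth (α := fun _ => ℝ) u ((1 - u) • z) : Fin (d + 1) → ℝ) j ^ (a - 1)
      = u ^ (a - 1) * ∏ j, ((1 - u) * z j) ^ (a - 1) := by
    rw [Fin.prod_univ_succAbove _ i]
    simp
  have hiff : ((∀ j, 0 ≤ (i.insertNth (α := fun _ => ℝ) u ((1 - u) • z) : Fin (d + 1) → ℝ) j) ∧
      u + (1 - u) * ∑ j, z j ≤ 1) ↔ ((∀ j, 0 ≤ z j) ∧ ∑ j, z j ≤ 1) := by
    refine and_congr ?_ ?_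
    · rw [Fin.forall_iff_succAbove i]
      simp [hu.1.le, hc]
    · constructor
      · intro h
        have : (1 - u) * ∑ j, z j ≤ (1 - u) * 1 := by linarith
        exact le_of_mul_le_mul_left this hc
      · intro h
        have : (1 - u) * ∑ j, z j ≤ (1 - u) * 1 := mul_le_mul_of_nonneg_left h hc.le
        linarith
  unfold dirichletWeight
  rw [hsum, hprod]
  by_cases h : (∀ j, 0 ≤ z j) ∧ ∑ j, z j ≤ 1
  · rw [if_pos (hiff.2 h), if_pos h, ← ENNReal.ofReal_mul]
    · congr 1
      have e1 : ∏ j, ((1 - u) * z j) ^ (a - 1) = ((1 - u) ^ (a - 1)) ^ d * ∏ j, z j ^ (a - 1) := by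
        rw [Finset.prod_congr rfl fun j _ => Real.mul_rpow hc.le (h.1 j), Finset.prod_mul_distrib]
        simp
      rw [e1, show 1 - (u + (1 - u) * ∑ j, z j) = (1 - u) * (1 - ∑ j, z j) by ring,
        Real.mul_rpow hc.le (by linarith [h.2])]
      ring
    · have := hu.1
      positivity
  · rw [if_neg (fun h' => h (hiff.1 h')), if_neg h, mul_zero]

theorem piFinSuccAbove_symm_eq_insertNth {d : ℕ} (i : Fin (d + 1)) (z : ℝ × (Fin d → ℝ)) :
    (MeasurableEquiv.piFinSuccAbove (fun _ : Fin (d + 1) => ℝ) i).symm z =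
      i.insertNth (α := fun _ => ℝ) z.1 z.2 := rfl

/-- Fubini along coordinate `i`, with each slice rescaled by `1 - u`. The Jacobian `(1 - u) ^ d`
brings the exponent of `1 - u` to `d * a + b - 1`, so the marginal is a Beta density up to a
constant. -/
theorem lintegral_mul_dirichletWeight_succ (d : ℕ) (a b : ℝ) (i : Fin (d + 1)) {g : ℝ → ENNReal}
    (hg : Measurable g) :
    ∫⁻ x, g (x i) * dirichletWeight (d + 1) a b x =
      (∫⁻ u in Ioo (0 : ℝ) 1, g u * ENNReal.ofReal (u ^ (a - 1) * (1 - u) ^ (d * a + b - 1))) *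
        ∫⁻ z, dirichletWeight d a b z := by
  have hD := measurable_dirichletWeight (d + 1) a b
  have he := (volume_preserving_piFinSuccAbove (fun _ : Fin (d + 1) => ℝ) i).symm
  have hF : Measurable fun x : Fin (d + 1) → ℝ => g (x i) * dirichletWeight (d + 1) a b x :=
    (hg.comp (measurable_pi_apply i)).mul hD
  rw [← he.lintegral_comp_emb (MeasurableEquiv.measurableEmbedding _), Measure.volume_eq_prod,
    lintegral_prod]
  swap
  · exact (hF.comp
      (MeasurableEquiv.piFinSuccAbove (fun _ : Fin (d + 1) => ℝ) i).symm.measurable).aemeasurable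
  simp only [piFinSuccAbove_symm_eq_insertNth, Fin.insertNth_apply_same]
  rw [← lintegral_mul_const'' _ (by fun_prop), ← lintegral_indicator measurableSet_Ioo]
  refine lintegral_congr_ae ?_
  -- The endpoints are null; discarding them leaves `0 < u < 1`, where the rescaling is valid, or a
  -- vanishing weight.
  filter_upwards [Measure.ae_ne volume 0, Measure.ae_ne volume 1] with u hu0 hu1
  have hslice : Measurable fun x : Fin d → ℝ =>
      dirichletWeight (d + 1) a b (i.insertNth (α := fun _ => ℝ) u x) :=
    (hD.comp ((MeasurableEquiv.piFinSuccAbove (fun _ => ℝ) i).symm.measurable)).comp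
      (measurable_prodMk_left (x := u))
  rw [lintegral_const_mul _ hslice]
  by_cases hu : u ∈ Ioo (0 : ℝ) 1
  · have hc : 0 < 1 - u := by linarith [hu.2]
    rw [indicator_of_mem hu, lintegral_pi_eq_smul d hc]
    simp_rw [dirichletWeight_insertNth_smul a b i hu]
    rw [lintegral_const_mul _ (measurable_dirichletWeight d a b), mul_assoc (g u), ← mul_assoc
      (ENNReal.ofReal ((1 - u) ^ d)), ← ENNReal.ofReal_mul (by positivity)]
    congr 3
    rw [← Real.rpow_natCast, ← Real.rpow_natCast, ← Real.rpow_mul hc.le,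
      show d * a + b - 1 = d + (a - 1) * d + (b - 1) by ring, Real.rpow_add hc, Real.rpow_add hc]
    ring
  · rw [indicator_of_notMem hu]
    have : ∀ x : Fin d → ℝ, dirichletWeight (d + 1) a b (i.insertNth (α := fun _ => ℝ) u x) = 0 := by
      intro x
      refine if_neg fun h => hu ?_
      have h0 : 0 ≤ u := by simpa using h.1 i
      have h1 : u ≤ 1 := by
        refine le_trans ?_ h.2
        refine le_trans (le_of_eq ?_) (Finset.single_le_sum (fun j _ => h.1 j) (Finset.mem_univ i))
        simp
      exact ⟨lt_of_le_of_ne h0 (Ne.symm hu0), lt_of_le_of_ne h1 hu1⟩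
    simp [this]

theorem lintegral_beta {a b : ℝ} (ha : 0 < a) (hb : 0 < b) :
    ∫⁻ u in Ioo (0 : ℝ) 1, ENNReal.ofReal (u ^ (a - 1) * (1 - u) ^ (b - 1)) =
      ENNReal.ofReal (ProbabilityTheory.beta a b) := by
  have hB := ProbabilityTheory.beta_pos ha hb
  have h := ProbabilityTheory.lintegral_betaPDF_eq_one ha hb
  rw [ProbabilityTheory.lintegral_betaPDF] at h
  have e : ∀ u : ℝ, ENNReal.ofReal (1 / ProbabilityTheory.beta a b * u ^ (a - 1) *
      (1 - u) ^ (b - 1)) = ENNReal.ofReal (1 / ProbabilityTheory.beta a b) *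
        ENNReal.ofReal (u ^ (a - 1) * (1 - u) ^ (b - 1)) := by
    intro u
    rw [← ENNReal.ofReal_mul (by positivity), mul_assoc]
  simp_rw [e] at h
  rw [lintegral_const_mul _ (by fun_prop)] at h
  calc _ = ENNReal.ofReal (ProbabilityTheory.beta a b) *
        (ENNReal.ofReal (1 / ProbabilityTheory.beta a b) *
        ∫⁻ u in Ioo (0 : ℝ) 1, ENNReal.ofReal (u ^ (a - 1) * (1 - u) ^ (b - 1))) := by
        rw [← mul_assoc, ← ENNReal.ofReal_mul hB.le, mul_one_div_cancel hB.ne']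
        simp
    _ = _ := by rw [h, mul_one]

/-- Integrating out one coordinate gives a Beta function, whose factor `Γ(d * a + b)` cancels the
denominator of the induction hypothesis. -/
theorem lintegral_dirichletWeight (d : ℕ) {a b : ℝ} (ha : 0 < a) (hb : 0 < b) :
    ∫⁻ x, dirichletWeight d a b x =
      ENNReal.ofReal (Real.Gamma a ^ d * Real.Gamma b / Real.Gamma (d * a + b)) := by
  induction d with
  | zero =>
    rw [lintegral_unique]
    have : Real.Gamma b ≠ 0 := (Real.Gamma_pos_of_pos hb).ne'
    simp [dirichletWeight, this, volume_pi]
  | succ d ih =>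
    have h := lintegral_mul_dirichletWeight_succ d a b 0 (g := fun _ => 1) measurable_const
    have hb' : 0 < d * a + b := by positivity
    simp only [one_mul] at h
    rw [h, lintegral_beta ha hb', ih, ProbabilityTheory.beta, ← ENNReal.ofReal_mul]
    · congr 1
      have := (Real.Gamma_pos_of_pos hb').ne'
      rw [show ((d + 1 : ℕ) : ℝ) * a + b = a + (d * a + b) by push_cast; ring, pow_succ]
      field_simp
    · have := Real.Gamma_pos_of_pos hb'
      have := Real.Gamma_pos_of_pos ha
      have := Real.Gamma_pos_of_pos (show 0 < a + (d * a + b) by positivity)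
      positivity

/-- The last spacing is not a coordinate of the density. With the other coordinates fixed, a
reflection of the first one exchanges it with the last spacing; it preserves Lebesgue measure, and
also the weight because both parameters equal `a`. -/
theorem lintegral_last_dirichletWeight (d : ℕ) (a : ℝ) {g : ℝ → ENNReal} (hg : Measurable g) :
    ∫⁻ x, g (1 - ∑ i, x i) * dirichletWeight (d + 1) a a x =
      ∫⁻ x, g (x 0) * dirichletWeight (d + 1) a a x := by
  have hD := measurable_dirichletWeight (d + 1) a a
  have he := (volume_preserving_piFinSuccAbove (fun _ : Fin (d + 1) => ℝ) 0).symm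
  have hF : Measurable fun x : Fin (d + 1) → ℝ => g (x 0) * dirichletWeight (d + 1) a a x :=
    (hg.comp (measurable_pi_apply 0)).mul hD
  have hG : Measurable fun x : Fin (d + 1) → ℝ =>
      g (1 - ∑ i, x i) * dirichletWeight (d + 1) a a x := by fun_prop
  rw [← he.lintegral_comp_emb (MeasurableEquiv.measurableEmbedding _),
    ← he.lintegral_comp_emb (MeasurableEquiv.measurableEmbedding _), Measure.volume_eq_prod,
    lintegral_prod_symm, lintegral_prod_symm]
  rotate_left
  · exact (hF.comp
      (MeasurableEquiv.piFinSuccAbove (fun _ : Fin (d + 1) => ℝ) 0).symm.measurable).aemeasurable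
  · exact (hG.comp
      (MeasurableEquiv.piFinSuccAbove (fun _ : Fin (d + 1) => ℝ) 0).symm.measurable).aemeasurable
  refine lintegral_congr fun x => ?_
  rw [← lintegral_sub_left_eq_self _ (1 - ∑ i, x i)]
  refine lintegral_congr fun u => ?_
  simp only [piFinSuccAbove_symm_eq_insertNth, Fin.insertNth_zero', Fin.sum_univ_succ, Fin.cons_zero, Fin.cons_succ]
  congr 1
  · congr 1; ring
  · unfold dirichletWeight
    simp only [Fin.sum_univ_succ, Fin.prod_univ_succ, Fin.cons_zero, Fin.cons_succ,
      Fin.forall_fin_succ]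
    rw [show 1 - (1 - ∑ i, x i - u + ∑ i, x i) = u by ring,
      show 1 - (u + ∑ i, x i) = 1 - ∑ i, x i - u by ring]
    have hiff : ((0 ≤ 1 - ∑ i, x i - u ∧ ∀ i, 0 ≤ x i) ∧ 1 - ∑ i, x i - u + ∑ i, x i ≤ 1) ↔
        ((0 ≤ u ∧ ∀ i, 0 ≤ x i) ∧ u + ∑ i, x i ≤ 1) := by
      constructor
      · rintro ⟨⟨h1, h2⟩, h3⟩
        exact ⟨⟨by linarith, h2⟩, by linarith⟩
      · rintro ⟨⟨h1, h2⟩, h3⟩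
        exact ⟨⟨by linarith, h2⟩, by linarith⟩
    simp only [hiff]
    congr 2
    ring

theorem dirichletPDF_eq {d : ℕ} {α : ℝ} (hα : 0 < α) (x : Fin d → ℝ) :
    dirichletPDF d α x = ENNReal.ofReal (Real.Gamma ((d + 1) * α) / Real.Gamma α ^ (d + 1)) *
      dirichletWeight d α α x := by
  unfold dirichletPDF dirichletWeight
  split_ifs with h
  · rw [← ENNReal.ofReal_mul]
    have := Real.Gamma_pos_of_pos (show 0 < (d + 1) * α by positivity)
    have := Real.Gamma_pos_of_pos hα
    positivity
  · simp

/-- The `t`-th moment of the sum of all spacings but one. -/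
def spacingMoment (d : ℕ) (α : ℝ) (t : ℕ) : ℝ :=
  ∏ s ∈ Finset.range t, (d * α + s) / ((d + 1) * α + s)

theorem Gamma_add_nat {x : ℝ} (hx : 0 < x) (t : ℕ) :
    Real.Gamma (x + t) = Real.Gamma x * ∏ s ∈ Finset.range t, (x + s) := by
  induction t with
  | zero => simp
  | succ t ih =>
    rw [Nat.cast_succ, ← add_assoc, Real.Gamma_add_one (by positivity), ih, Finset.prod_range_succ]
    ring

theorem measurable_snoc (d : ℕ) : Measurable fun x : Fin d → ℝ =>
    (Fin.snoc (α := fun _ => ℝ) x (1 - ∑ i, x i) : Fin (d + 1) → ℝ) := by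
  refine measurable_pi_iff.2 fun i => ?_
  refine Fin.lastCases ?_ (fun j => ?_) i
  · simp only [Fin.snoc_last]; fun_prop
  · simp only [Fin.snoc_castSucc]; fun_prop

theorem lintegral_dirichlet_comp_apply {d : ℕ} (hd : 1 ≤ d) {α : ℝ} (hα : 0 < α) (i : Fin (d + 1))
    {g : ℝ → ENNReal} (hg : Measurable g) :
    ∫⁻ y, g (y i) ∂dirichlet d α =
      ENNReal.ofReal (Real.Gamma ((d + 1) * α) / Real.Gamma α ^ (d + 1)) *
        ((∫⁻ u in Ioo (0 : ℝ) 1, g u * ENNReal.ofReal (u ^ (α - 1) * (1 - u) ^ (d * α - 1))) *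
          ENNReal.ofReal (Real.Gamma α ^ d / Real.Gamma (d * α))) := by
  obtain ⟨e, rfl⟩ : ∃ e, d = e + 1 := ⟨d - 1, by omega⟩
  have hm : Measurable (dirichletPDF (e + 1) α) := by
    simp_rw [funext (dirichletPDF_eq (d := e + 1) hα)]
    exact measurable_const.mul (measurable_dirichletWeight _ _ _)
  have hgi : Measurable fun y : Fin (e + 1 + 1) → ℝ => g (y i) := hg.comp (measurable_pi_apply i)
  rw [dirichlet, lintegral_map hgi (measurable_snoc _)]
  refine (lintegral_withDensity_eq_lintegral_mul _ hm (hgi.comp (measurable_snoc _))).trans ?_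
  simp only [Pi.mul_apply, dirichletPDF_eq hα, Function.comp_def]
  simp_rw [mul_assoc]
  rw [lintegral_const_mul]
  swap
  · exact (measurable_dirichletWeight _ _ _).mul (hgi.comp (measurable_snoc _))
  congr 1
  have key : ∀ j : Fin (e + 1), ∫⁻ x, g (x j) * dirichletWeight (e + 1) α α x =
      (∫⁻ u in Ioo (0 : ℝ) 1, g u * ENNReal.ofReal (u ^ (α - 1) *
        (1 - u) ^ ((e + 1 : ℕ) * α - 1))) *
          ENNReal.ofReal (Real.Gamma α ^ (e + 1) / Real.Gamma ((e + 1 : ℕ) * α)) := by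
    intro j
    rw [lintegral_mul_dirichletWeight_succ e α α j hg, lintegral_dirichletWeight e hα hα,
      show ((e + 1 : ℕ) : ℝ) * α = e * α + α by push_cast; ring, pow_succ]
  simp_rw [mul_comm (dirichletWeight _ _ _ _)]
  refine Fin.lastCases ?_ (fun j => ?_) i
  · simp only [Fin.snoc_last]
    rw [lintegral_last_dirichletWeight e α hg, key 0]
  · simp only [Fin.snoc_castSucc]
    exact key j

/-- The factor `(1 - u) ^ t` shifts the second Beta parameter from `d * α` to `d * α + t`; the
functional equation of `Γ` turns the ratio into a product. -/
theorem lintegral_dirichlet_pow {d : ℕ} (hd : 1 ≤ d) {α : ℝ} (hα : 0 < α) (i : Fin (d + 1))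
    (t : ℕ) : ∫⁻ y, ENNReal.ofReal (1 - y i) ^ t ∂dirichlet d α =
      ENNReal.ofReal (spacingMoment d α t) := by
  have hd' : (0 : ℝ) < d := by exact_mod_cast hd
  rw [lintegral_dirichlet_comp_apply hd hα i (g := fun u => ENNReal.ofReal (1 - u) ^ t)
    (by fun_prop)]
  have h1 : ∫⁻ u in Ioo (0 : ℝ) 1, ENNReal.ofReal (1 - u) ^ t *
      ENNReal.ofReal (u ^ (α - 1) * (1 - u) ^ (d * α - 1)) =
      ENNReal.ofReal (ProbabilityTheory.beta α (d * α + t)) := by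
    rw [← lintegral_beta hα (by positivity)]
    refine setLIntegral_congr_fun measurableSet_Ioo fun u hu => ?_
    have hc : 0 < 1 - u := by linarith [hu.2]
    have := hu.1
    rw [← ENNReal.ofReal_pow hc.le, ← ENNReal.ofReal_mul (by positivity), add_sub_right_comm,
      Real.rpow_add hc, Real.rpow_natCast]
    congr 1
    ring
  have g1 := Real.Gamma_pos_of_pos hα
  have g2 := Real.Gamma_pos_of_pos (show 0 < d * α by positivity)
  have g3 := Real.Gamma_pos_of_pos (show 0 < (d + 1) * α by positivity)
  rw [h1, ← ENNReal.ofReal_mul (ProbabilityTheory.beta_pos hα (by positivity)).le,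
    ← ENNReal.ofReal_mul (by positivity)]
  congr 1
  rw [ProbabilityTheory.beta, show α + (d * α + t) = (d + 1) * α + t by ring,
    Gamma_add_nat (by positivity), Gamma_add_nat (by positivity), spacingMoment,
    Finset.prod_div_distrib, pow_succ]
  have : 0 < ∏ s ∈ Finset.range t, ((d + 1) * α + s) :=
    Finset.prod_pos fun s _ => by positivity
  field_simp

theorem dirichlet_univ {d : ℕ} (hd : 1 ≤ d) {α : ℝ} (hα : 0 < α) : dirichlet d α univ = 1 := by
  simpa [spacingMoment] using lintegral_dirichlet_pow hd hα 0 0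

theorem ae_dirichlet (d : ℕ) {α : ℝ} (hα : 0 < α) :
    ∀ᵐ y ∂dirichlet d α, (∀ i, 0 ≤ y i) ∧ ∑ i, y i = 1 := by
  have hm : Measurable (dirichletPDF d α) := by
    simp_rw [funext (dirichletPDF_eq (d := d) hα)]
    exact measurable_const.mul (measurable_dirichletWeight _ _ _)
  rw [dirichlet, ae_map_iff (measurable_snoc d).aemeasurable, ae_withDensity_iff hm]
  · refine Filter.Eventually.of_forall fun x hx => ?_
    have h : (∀ i, 0 ≤ x i) ∧ ∑ i, x i ≤ 1 := by
      by_contra h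
      exact hx (if_neg h)
    refine ⟨fun i => ?_, ?_⟩
    · refine Fin.lastCases ?_ (fun j => ?_) i
      · simpa using h.2
      · simpa using h.1 j
    · simp [Fin.sum_univ_castSucc]
  · refine MeasurableSet.inter (s₁ := {y : Fin (d + 1) → ℝ | ∀ i, 0 ≤ y i})
      (s₂ := {y : Fin (d + 1) → ℝ | ∑ i, y i = 1}) ?_ ?_
    · rw [ofPred_forall]
      exact MeasurableSet.iInter fun i => measurableSet_le measurable_const (measurable_pi_apply i)
    · exact measurableSet_eq_fun (by fun_prop) measurable_const


/-! ### Flips of a polynomial, and perfect learning -/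

/-- Since `0` is labeled positive, `f` is first raised by an `ε` small enough to keep its negative
sample values negative. The labels are then strict signs of `g = f + ε`, so each flip gives a root
of `g` strictly between consecutive sample points, and these roots are distinct. -/
theorem card_flips_label_le {n : ℕ} (f : Polynomial ℝ) {x : Fin n → ℝ} (hx : Monotone x) :
    (flips fun q => label f (x q)).card ≤ f.natDegree := by
  obtain ⟨ε, hε, hpos⟩ : ∃ ε : ℝ, (∀ q, f.eval (x q) < 0 → f.eval (x q) + ε < 0) ∧ 0 < ε := by
    have h1 : ∀ᶠ ε in nhdsWithin (0 : ℝ) (Ioi 0),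
        ∀ q, f.eval (x q) < 0 → f.eval (x q) + ε < 0 := by
      refine Filter.eventually_all.2 fun q => ?_
      by_cases h : f.eval (x q) < 0
      · filter_upwards [Ioo_mem_nhdsGT (show 0 < -f.eval (x q) by linarith)] with ε hε _
        linarith [hε.2]
      · exact Filter.Eventually.of_forall fun _ h' => absurd h' h
    exact (h1.and self_mem_nhdsWithin).exists
  set g := f + Polynomial.C ε with hg
  have heval : ∀ z, g.eval z = f.eval z + ε := fun z => by simp [hg]
  have hroot : ∀ s ∈ flips (fun q => label f (x q)), ∃ r, g.eval r = 0 ∧ g ≠ 0 ∧ x s < r ∧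
      ∀ q, s < q → r < x q := by
    intro s hs
    obtain ⟨t, hst, hne⟩ := mem_flips.1 hs
    have hlt : s < t := Fin.lt_def.2 (by omega)
    have hcont : ContinuousOn (fun z => g.eval z) (Icc (x s) (x t)) :=
      g.continuous.continuousOn
    -- If `g = 0` then `f = -ε` everywhere, against the choice of `ε` at `x s`.
    have hg0 : g ≠ 0 := by
      intro h0
      have e : ∀ z, f.eval z + ε = 0 := fun z => by rw [← heval, h0, Polynomial.eval_zero]
      exact absurd (e (x s)) (hε s (by linarith [e (x s)])).ne
    have hle := hx hlt.le
    obtain ⟨r, hr, hr0⟩ : ∃ r ∈ Ioo (x s) (x t), g.eval r = 0 := by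
      simp only [label, ne_eq, decide_eq_decide] at hne
      by_cases h : 0 ≤ f.eval (x s)
      · have h' : f.eval (x t) < 0 := by
          by_contra h'
          exact hne (iff_of_true h (not_lt.1 h'))
        exact intermediate_value_Ioo' hle hcont
          ⟨by rw [heval]; exact hε t h', by rw [heval]; linarith⟩
      · have h' : 0 ≤ f.eval (x t) := by
          by_contra h'
          exact hne (iff_of_false h h')
        exact intermediate_value_Ioo hle hcont
          ⟨by rw [heval]; exact hε s (not_le.1 h), by rw [heval]; linarith⟩
    refine ⟨r, hr0, hg0, hr.1, fun q hq => hr.2.trans_le (hx ?_)⟩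
    rw [Fin.lt_def] at hq
    exact Fin.le_def.2 (by omega)
  choose! r hr0 hg0 hr1 hr2 using hroot
  calc (flips fun q => label f (x q)).card ≤ g.roots.toFinset.card := by
        refine Finset.card_le_card_of_injOn r (fun s hs => ?_) ?_
        · simpa [hg0 s hs] using hr0 s hs
        · intro s hs s' hs' h
          by_contra hne
          rcases lt_or_gt_of_ne hne with hlt | hlt
          · have := hr2 s hs s' hlt
            have := hr1 s' hs'
            linarith
          · have := hr2 s' hs' s hlt
            have := hr1 s hs
            linarith
    _ ≤ g.roots.card := Multiset.toFinset_card_le _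
    _ ≤ g.natDegree := g.card_roots'
    _ = f.natDegree := Polynomial.natDegree_add_C

theorem perfectlyLearns_sampleAndSearch (d : ℕ) : PerfectlyLearns d (sampleAndSearch d) := by
  intro n S f hf T hT
  obtain ⟨σ, -, rfl⟩ := (PMF.mem_support_map_iff ..).1 hT
  have hflips : (flips (labels f S ∘ Tuple.sort S)).card ≤ d :=
    (card_flips_label_le f (Tuple.monotone_sort S)).trans hf
  rw [sampleAndSearchTree, QueryTree.run_bind, QueryTree.run_mapQuery,
    run_sampleThenSearch hflips]
  · funext i
    simp [QueryTree.run]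
  · intro q hq
    simp at hq
  · intro q
    right
    simpa using σ.surjective q

/-! ### Gaps between roots and the stopping condition -/

/-- The open interval between two successive roots (or `0`, or `1`) with spacings `y`. -/
def gap {d : ℕ} (y : Fin (d + 1) → ℝ) (i : Fin (d + 1)) : Set ℝ :=
  Ioo (∑ j ∈ Finset.Iio i, y j) (∑ j ∈ Finset.Iic i, y j)

theorem rootOfSpacings_lt_of_mem_gap {d : ℕ} {y : Fin (d + 1) → ℝ} (hy : ∀ i, 0 ≤ y i)
    {i : Fin (d + 1)} {k : Fin d} (hk : k.castSucc < i) {x : ℝ} (hx : x ∈ gap y i) :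
    rootOfSpacings y k < x := by
  refine lt_of_le_of_lt (Finset.sum_le_sum_of_subset_of_nonneg ?_ fun j _ _ => hy j) hx.1
  intro j hj
  exact Finset.mem_Iio.2 ((Finset.mem_Iic.1 hj).trans_lt hk)

theorem lt_rootOfSpacings_of_mem_gap {d : ℕ} {y : Fin (d + 1) → ℝ} (hy : ∀ i, 0 ≤ y i)
    {i : Fin (d + 1)} {k : Fin d} (hk : i ≤ k.castSucc) {x : ℝ} (hx : x ∈ gap y i) :
    x < rootOfSpacings y k := by
  refine lt_of_lt_of_le hx.2 (Finset.sum_le_sum_of_subset_of_nonneg ?_ fun j _ _ => hy j)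
  intro j hj
  exact Finset.mem_Iic.2 ((Finset.mem_Iic.1 hj).trans hk)

theorem lt_of_mem_gap {d : ℕ} {y : Fin (d + 1) → ℝ} (hy : ∀ i, 0 ≤ y i) {i j : Fin (d + 1)}
    (hij : i < j) {x z : ℝ} (hx : x ∈ gap y i) (hz : z ∈ gap y j) : x < z := by
  refine hx.2.trans_le (le_trans ?_ hz.1.le)
  refine Finset.sum_le_sum_of_subset_of_nonneg ?_ fun j _ _ => hy j
  intro k hk
  exact Finset.mem_Iio.2 ((Finset.mem_Iic.1 hk).trans_lt hij)

/-- Between adjacent gaps only the factor of root `j` changes sign, so the two values have negative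
product. -/
theorem label_ne_of_mem_gap {d : ℕ} {y : Fin (d + 1) → ℝ} (hy : ∀ i, 0 ≤ y i) {a : ℝ}
    (ha : a ≠ 0) (j : Fin d) {x z : ℝ} (hx : x ∈ gap y j.castSucc) (hz : z ∈ gap y j.succ) :
    label (polyOfSpacings a y) x ≠ label (polyOfSpacings a y) z := by
  have hneg : (polyOfSpacings a y).eval x * (polyOfSpacings a y).eval z < 0 := by
    have e : (polyOfSpacings a y).eval x * (polyOfSpacings a y).eval z =
        a ^ 2 * ∏ k, (x - rootOfSpacings y k) * (z - rootOfSpacings y k) := by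
      simp only [polyOfSpacings, Polynomial.eval_mul, Polynomial.eval_C, Polynomial.eval_prod,
        Polynomial.eval_sub, Polynomial.eval_X, Finset.prod_mul_distrib]
      ring
    rw [e, ← Finset.mul_prod_erase _ _ (Finset.mem_univ j)]
    refine mul_neg_of_pos_of_neg (by positivity) (mul_neg_of_neg_of_pos ?_ ?_)
    · refine mul_neg_of_neg_of_pos ?_ ?_
      · linarith [lt_rootOfSpacings_of_mem_gap hy le_rfl hx]
      · linarith [rootOfSpacings_lt_of_mem_gap hy (Fin.castSucc_lt_succ (i := j)) hz]
    · refine Finset.prod_pos fun k hk => ?_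
      rcases lt_or_gt_of_ne (Finset.ne_of_mem_erase hk) with h | h
      · have h1 := rootOfSpacings_lt_of_mem_gap hy (Fin.castSucc_lt_castSucc_iff.2 h) hx
        have h2 := rootOfSpacings_lt_of_mem_gap hy
          ((Fin.castSucc_lt_castSucc_iff.2 h).trans Fin.castSucc_lt_succ) hz
        exact mul_pos (by linarith) (by linarith)
      · have h1 := lt_rootOfSpacings_of_mem_gap hy (Fin.castSucc_lt_castSucc_iff.2 h).le hx
        have h2 := lt_rootOfSpacings_of_mem_gap hy (Fin.succ_le_castSucc_iff.2 h) hz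
        exact mul_pos_of_neg_of_neg (by linarith) (by linarith)
  intro h
  simp only [label, decide_eq_decide] at h
  by_cases h0 : 0 ≤ (polyOfSpacings a y).eval x
  · exact absurd hneg (not_lt.2 (mul_nonneg h0 (h.1 h0)))
  · exact absurd hneg (not_lt.2 (mul_pos_of_neg_of_neg (not_le.1 h0)
      (not_le.1 fun h' => h0 (h.2 h'))).le)

theorem seesFlips_of_forall_gap {n d : ℕ} {y : Fin (d + 1) → ℝ} (hy : ∀ i, 0 ≤ y i) {a : ℝ}
    (ha : a ≠ 0) {x : Fin n → ℝ} (hx : Monotone x) (L : List (Fin n))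
    (known : Fin n → Option Bool) (h : ∀ i, ∃ q ∈ L, x q ∈ gap y i) :
    SeesFlips d (recordLabels (fun q => label (polyOfSpacings a y) (x q)) L known) := by
  choose p hpL hp using h
  refine ⟨p, fun i j hij => ?_, fun j => ?_, fun j => ?_⟩
  · exact hx.reflect_lt (lt_of_mem_gap hy hij (hp i) (hp j))
  · rw [recordLabels_of_mem _ _ _ _ (hpL j)]
    simp
  · rw [recordLabels_of_mem _ _ _ _ (hpL _), recordLabels_of_mem _ _ _ _ (hpL _)]
    exact fun h => label_ne_of_mem_gap hy ha j (hp _) (hp _) (Option.some_injective _ h)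

/-- Samples and spacings for which the first `t` points, in the order `τ`, miss some gap. -/
def missSet {n : ℕ} (d : ℕ) (τ : Equiv.Perm (Fin n)) (t : ℕ) :
    Set ((Fin n → ℝ) × (Fin (d + 1) → ℝ)) :=
  {z | ∃ i, ∀ s : Fin n, (s : ℕ) < t → z.1 (τ s) ∉ gap z.2 i}

/-- The order `σ` refers to sorted positions; in the original indices the queries follow `Tuple.sort
S * σ`. -/
theorem cost_sampleAndSearchTree_le {n d : ℕ} {y : Fin (d + 1) → ℝ} (hy : ∀ i, 0 ≤ y i) {a : ℝ}
    (ha : a ≠ 0) (S : Fin n → ℝ) (σ : Equiv.Perm (Fin n)) :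
    ((sampleAndSearchTree d S σ).cost (labels (polyOfSpacings a y) S) : ENNReal) ≤
      (∑ t ∈ Finset.range n, (missSet d (Tuple.sort S * σ) t).indicator 1 (S, y)) +
        d * Nat.clog 2 n := by
  classical
  rw [sampleAndSearchTree, QueryTree.cost_bind, QueryTree.cost_mapQuery]
  simp only [QueryTree.cost, add_zero]
  refine (Nat.cast_le.2 (cost_sampleThenSearch_le _ _ _)).trans ?_
  rw [Nat.cast_add, Nat.cast_sum, Nat.cast_mul]
  gcongr
  rw [List.length_map, List.length_finRange]
  refine Finset.sum_le_sum fun t _ => ?_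
  by_cases h : (S, y) ∈ missSet d (Tuple.sort S * σ) t
  · rw [indicator_of_mem h]
    split_ifs <;> simp
  · rw [if_pos]
    · simp
    · refine seesFlips_of_forall_gap hy ha (Tuple.monotone_sort S) _ _ fun i => ?_
      simp only [missSet, mem_ofPred_eq, not_exists, not_forall, not_not] at h
      obtain ⟨s, hs, hmem⟩ := h i
      refine ⟨σ s, ?_, hmem⟩
      rw [← List.map_take]
      refine List.mem_map.2 ⟨s, ?_, rfl⟩
      rw [List.mem_take_iff_getElem]
      exact ⟨s, by simp [hs], by simp⟩

theorem tsum_map_mul {α β : Type*} (p : PMF α) (f : α → β) (c : β → ENNReal) :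
    ∑' b, (p.map f) b * c b = ∑' a, p a * c (f a) := by
  classical
  simp_rw [PMF.map_apply, ← ENNReal.tsum_mul_right]
  rw [ENNReal.tsum_comm]
  refine tsum_congr fun a => ?_
  rw [tsum_eq_single (f a)]
  · simp
  · intro b hb
    simp [hb]

/-- Left multiplication by `Tuple.sort S` permutes the orders, so the order in original indices is
again uniform. After this reindexing `τ` does not depend on `S`, and for fixed `τ` the first `t`
points are independent and uniform. -/
theorem meanCost_sampleAndSearch_le {n d : ℕ} {y : Fin (d + 1) → ℝ} (hy : ∀ i, 0 ≤ y i) {a : ℝ}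
    (ha : a ≠ 0) (S : Fin n → ℝ) :
    meanCost (sampleAndSearch d) S (polyOfSpacings a y) ≤
      ∑ τ : Equiv.Perm (Fin n), (Fintype.card (Equiv.Perm (Fin n)) : ENNReal)⁻¹ *
        ((∑ t ∈ Finset.range n, (missSet d τ t).indicator 1 (S, y)) + d * Nat.clog 2 n) := by
  rw [meanCost, sampleAndSearch, tsum_map_mul, tsum_fintype,
    ← Equiv.sum_comp (Equiv.mulLeft (Tuple.sort S)) fun τ =>
      (Fintype.card (Equiv.Perm (Fin n)) : ENNReal)⁻¹ * _]
  refine Finset.sum_le_sum fun σ _ => ?_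
  rw [PMF.uniformOfFintype_apply]
  gcongr
  exact cost_sampleAndSearchTree_le hy ha S σ

/-! ### Probability of missing a gap, and the expected cost -/

instance (n : ℕ) : IsProbabilityMeasure (uniformSample n) := by
  have : IsProbabilityMeasure (volume.restrict (Icc (0 : ℝ) 1)) := ⟨by simp⟩
  unfold uniformSample
  infer_instance

instance (d : ℕ) (α : ℝ) : SFinite (dirichlet d α) := by
  unfold dirichlet
  infer_instance

theorem volume_gap_compl {d : ℕ} {y : Fin (d + 1) → ℝ} (hy : ∀ i, 0 ≤ y i) (hsum : ∑ i, y i = 1)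
    (i : Fin (d + 1)) :
    volume.restrict (Icc (0 : ℝ) 1) (gap y i)ᶜ = ENNReal.ofReal (1 - y i) := by
  have h1 : ∑ j ∈ Finset.Iic i, y j ≤ 1 := by
    rw [← hsum]
    exact Finset.sum_le_sum_of_subset_of_nonneg (Finset.subset_univ _) fun j _ _ => hy j
  have h0 : 0 ≤ ∑ j ∈ Finset.Iio i, y j := Finset.sum_nonneg fun j _ => hy j
  have hm : MeasurableSet (gap y i) := measurableSet_Ioo
  have e : ∑ j ∈ Finset.Iic i, y j = ∑ j ∈ Finset.Iio i, y j + y i := by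
    rw [← Finset.Iio_insert, Finset.sum_insert (by simp), add_comm]
  rw [Measure.restrict_apply hm.compl, inter_comm, ← sdiff_eq, measure_sdiff _ hm.nullMeasurableSet]
  · rw [gap, Real.volume_Icc, Real.volume_Ioo, ← ENNReal.ofReal_sub _ (by rw [e]; linarith [hy i]),
      e]
    congr 1
    ring
  · simp [gap]
  · exact fun z hz => ⟨h0.trans hz.1.le, hz.2.le.trans h1⟩

/-- The event is a box; as `t ≤ n`, exactly `t` of its sides are the complement of the gap. -/
theorem uniformSample_miss {n d : ℕ} {y : Fin (d + 1) → ℝ} (hy : ∀ i, 0 ≤ y i)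
    (hsum : ∑ i, y i = 1) (i : Fin (d + 1)) (τ : Equiv.Perm (Fin n)) {t : ℕ} (ht : t ≤ n) :
    uniformSample n {x | ∀ s : Fin n, (s : ℕ) < t → x (τ s) ∉ gap y i} =
      ENNReal.ofReal (1 - y i) ^ t := by
  classical
  have : IsProbabilityMeasure (volume.restrict (Icc (0 : ℝ) 1)) := ⟨by simp⟩
  have e : {x : Fin n → ℝ | ∀ s : Fin n, (s : ℕ) < t → x (τ s) ∉ gap y i} =
      univ.pi fun j => if ((τ.symm j : Fin n) : ℕ) < t then (gap y i)ᶜ else univ := by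
    ext x
    simp only [mem_ofPred_eq, mem_pi, mem_univ, true_imp_iff]
    rw [← τ.forall_congr_right (q := fun j =>
      x j ∈ if ((τ.symm j : Fin n) : ℕ) < t then (gap y i)ᶜ else univ)]
    refine forall_congr' fun s => ?_
    rw [Equiv.symm_apply_apply]
    split_ifs with h <;> simp [h]
  rw [e, uniformSample, Measure.pi_pi, ← Equiv.prod_comp τ]
  simp only [Equiv.symm_apply_apply, apply_ite (volume.restrict (Icc (0 : ℝ) 1)), measure_univ,
    volume_gap_compl hy hsum]
  rw [Finset.prod_ite, Finset.prod_const, Finset.prod_const_one, mul_one, Fin.card_filter_val_lt,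
    min_eq_right ht]

theorem measurableSet_missSet {n d : ℕ} (i : Fin (d + 1)) (τ : Equiv.Perm (Fin n)) (t : ℕ) :
    MeasurableSet {z : (Fin n → ℝ) × (Fin (d + 1) → ℝ) |
      ∀ s : Fin n, (s : ℕ) < t → z.1 (τ s) ∉ gap z.2 i} := by
  simp only [ofPred_forall]
  refine MeasurableSet.iInter fun s => MeasurableSet.iInter fun _ => ?_
  refine MeasurableSet.compl (s := {z : (Fin n → ℝ) × (Fin (d + 1) → ℝ) | z.1 (τ s) ∈ gap z.2 i})
    (MeasurableSet.inter
      (s₁ := {z : (Fin n → ℝ) × (Fin (d + 1) → ℝ) | ∑ j ∈ Finset.Iio i, z.2 j < z.1 (τ s)})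
      (s₂ := {z : (Fin n → ℝ) × (Fin (d + 1) → ℝ) | z.1 (τ s) < ∑ j ∈ Finset.Iic i, z.2 j}) ?_ ?_)
  · exact measurableSet_lt (by fun_prop) (by fun_prop)
  · exact measurableSet_lt (by fun_prop) (by fun_prop)

theorem missSet_eq_iUnion {n : ℕ} (d : ℕ) (τ : Equiv.Perm (Fin n)) (t : ℕ) :
    missSet d τ t = ⋃ i, {z | ∀ s : Fin n, (s : ℕ) < t → z.1 (τ s) ∉ gap z.2 i} := by
  ext z; simp [missSet]

/-- Union bound over the gaps, integrating over the sample first for fixed spacings. The trivial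
bound `1` is kept because it is the better one for small `t`. -/
theorem measure_missSet_le {n d : ℕ} (hd : 1 ≤ d) {α : ℝ} (hα : 0 < α) (τ : Equiv.Perm (Fin n))
    {t : ℕ} (ht : t ≤ n) :
    (uniformSample n).prod (dirichlet d α) (missSet d τ t) ≤
      ENNReal.ofReal (min 1 ((d + 1) * spacingMoment d α t)) := by
  have : IsProbabilityMeasure (dirichlet d α) := ⟨dirichlet_univ hd hα⟩
  rw [ENNReal.ofReal_min, le_min_iff, ENNReal.ofReal_one]
  refine ⟨prob_le_one, ?_⟩
  rw [missSet_eq_iUnion]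
  refine (measure_iUnion_fintype_le _ _).trans ?_
  have h : ∀ i : Fin (d + 1), (uniformSample n).prod (dirichlet d α)
      {z | ∀ s : Fin n, (s : ℕ) < t → z.1 (τ s) ∉ gap z.2 i} =
        ENNReal.ofReal (spacingMoment d α t) := by
    intro i
    rw [Measure.prod_apply_symm (measurableSet_missSet i τ t), ← lintegral_dirichlet_pow hd hα i t]
    refine lintegral_congr_ae ?_
    filter_upwards [ae_dirichlet d hα] with y hy
    exact uniformSample_miss hy.1 hy.2 i τ ht
  simp only [h, Finset.sum_const, Finset.card_univ, Fintype.card_fin]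
  rw [ENNReal.ofReal_mul (by positivity), nsmul_eq_mul]
  gcongr
  rw [← Nat.cast_succ, ENNReal.ofReal_natCast]

theorem expectedQueries_le {n d : ℕ} (hd : 1 ≤ d) {α a : ℝ} (hα : 0 < α) (ha : a ≠ 0) :
    expectedQueries (sampleAndSearch d) d n α a ≤
      ENNReal.ofReal (∑ t ∈ Finset.range n, min 1 ((d + 1) * spacingMoment d α t) +
        d * Nat.clog 2 n) := by
  have : IsProbabilityMeasure (dirichlet d α) := ⟨dirichlet_univ hd hα⟩
  have hM : ∀ t, 0 ≤ spacingMoment d α t := fun t =>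
    Finset.prod_nonneg fun s _ => by positivity
  have hms : ∀ (τ : Equiv.Perm (Fin n)) t, MeasurableSet (missSet d τ t) := fun τ t => by
    rw [missSet_eq_iUnion]
    exact MeasurableSet.iUnion fun i => measurableSet_missSet i τ t
  set B : ENNReal := ENNReal.ofReal (∑ t ∈ Finset.range n,
    min 1 ((d + 1) * spacingMoment d α t) + d * Nat.clog 2 n) with hB
  have hae : ∀ᵐ z ∂(uniformSample n).prod (dirichlet d α), ∀ i, 0 ≤ z.2 i :=
    Measure.quasiMeasurePreserving_snd.ae ((ae_dirichlet d hα).mono fun y hy => hy.1)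
  calc expectedQueries (sampleAndSearch d) d n α a
      ≤ ∫⁻ z, ∑ τ : Equiv.Perm (Fin n), (Fintype.card (Equiv.Perm (Fin n)) : ENNReal)⁻¹ *
        ((∑ t ∈ Finset.range n, (missSet d τ t).indicator 1 z) + d * Nat.clog 2 n)
          ∂(uniformSample n).prod (dirichlet d α) := by
        refine lintegral_mono_ae ?_
        filter_upwards [hae] with z hz
        exact meanCost_sampleAndSearch_le hz ha z.1
    _ ≤ ∑ τ : Equiv.Perm (Fin n), (Fintype.card (Equiv.Perm (Fin n)) : ENNReal)⁻¹ * B := by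
        have hind : ∀ (τ : Equiv.Perm (Fin n)) t,
            Measurable ((missSet d τ t).indicator (1 : _ × _ → ENNReal)) := fun τ t =>
          measurable_one.indicator (hms τ t)
        have hmeas : ∀ τ : Equiv.Perm (Fin n), Measurable fun z =>
            ∑ t ∈ Finset.range n, (missSet d τ t).indicator (1 : _ × _ → ENNReal) z := fun τ =>
          Finset.measurable_fun_sum _ fun t _ => hind τ t
        rw [lintegral_finsetSum _ fun τ _ => ((hmeas τ).add_const _).const_mul _]
        refine Finset.sum_le_sum fun τ _ => ?_
        rw [lintegral_const_mul _ ((hmeas τ).add_const _), lintegral_add_right _ measurable_const,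
          lintegral_finsetSum _ fun t _ => hind τ t]
        gcongr
        rw [hB, ENNReal.ofReal_add (Finset.sum_nonneg fun t _ => by have := hM t; positivity)
          (by positivity), ENNReal.ofReal_sum_of_nonneg fun t _ => by have := hM t; positivity]
        refine add_le_add (Finset.sum_le_sum fun t ht => ?_) ?_
        · rw [lintegral_indicator_one (hms τ t)]
          exact measure_missSet_le hd hα τ (Finset.mem_range.1 ht).le
        · rw [lintegral_const, measure_univ, mul_one, ENNReal.ofReal_mul (by positivity),
            ENNReal.ofReal_natCast, ENNReal.ofReal_natCast]
    _ = B := by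
        rw [Finset.sum_const, nsmul_eq_mul, ← mul_assoc, Finset.card_univ,
          ENNReal.mul_inv_cancel (by simp) (by simp), one_mul]


/-! ### Summing the moments -/

theorem two_thirds_le_log {n : ℕ} (hn : 2 ≤ n) : 2 / 3 ≤ Real.log n := by
  have h1 := Real.log_two_gt_d9
  have h2 : Real.log 2 ≤ Real.log n := Real.log_le_log (by norm_num) (by exact_mod_cast hn)
  linarith

theorem clog_two_le_log {n : ℕ} (hn : 2 ≤ n) : (Nat.clog 2 n : ℝ) ≤ 3 * Real.log n := by
  have h1 : Nat.clog 2 n ≤ Nat.log 2 n + 1 :=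
    (Nat.clog_le_iff_le_pow one_lt_two).2 (Nat.lt_pow_succ_log_self one_lt_two n).le
  have h2 : (Nat.log 2 n : ℝ) * Real.log 2 ≤ Real.log n := by
    rw [← Real.log_pow]
    refine Real.log_le_log (by positivity) ?_
    exact_mod_cast Nat.pow_log_le_self 2 (by omega)
  have h3 : (Nat.clog 2 n : ℝ) ≤ Nat.log 2 n + 1 := by exact_mod_cast h1
  have h4 := Real.log_two_gt_d9
  have h5 := two_thirds_le_log hn
  have h6 : Real.log 2 ≤ Real.log n := Real.log_le_log (by norm_num) (by exact_mod_cast hn)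
  nlinarith [Nat.cast_nonneg (α := ℝ) (Nat.log 2 n)]

theorem spacingMoment_nonneg (d : ℕ) {α : ℝ} (hα : 0 < α) (t : ℕ) : 0 ≤ spacingMoment d α t :=
  Finset.prod_nonneg fun s _ => by positivity

theorem spacingMoment_antitone (d : ℕ) {α : ℝ} (hα : 0 < α) : Antitone (spacingMoment d α) := by
  refine antitone_nat_of_succ_le fun t => ?_
  rw [spacingMoment, Finset.prod_range_succ]
  refine mul_le_of_le_one_right (spacingMoment_nonneg d hα t) ?_
  rw [div_le_one (by positivity)]
  nlinarith

/-- The product of `(d + s) / (d + 1 + s)` telescopes. -/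
theorem spacingMoment_one {d : ℕ} (hd : 1 ≤ d) (t : ℕ) :
    spacingMoment d 1 t = d / (d + t) := by
  have hd' : (0 : ℝ) < d := by exact_mod_cast hd
  induction t with
  | zero => simp [spacingMoment, hd'.ne']
  | succ t ih =>
    rw [spacingMoment, Finset.prod_range_succ, ← spacingMoment, ih]
    push_cast
    field_simp
    ring

/-- Numerators and denominators cancel at distance two. The result is written as a difference so
that its sum over `t` telescopes as well. -/
theorem spacingMoment_two {d : ℕ} (hd : 1 ≤ d) (t : ℕ) :
    spacingMoment d 2 t = 2 * d * (2 * d + 1) * (1 / (2 * d + t) - 1 / (2 * d + t + 1)) := by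
  have hd' : (0 : ℝ) < d := by exact_mod_cast hd
  induction t with
  | zero =>
    simp only [spacingMoment, Finset.range_zero, Finset.prod_empty, Nat.cast_zero]
    field_simp
    ring
  | succ t ih =>
    rw [spacingMoment, Finset.prod_range_succ, ← spacingMoment, ih]
    push_cast
    field_simp
    ring

theorem spacingMoment_le_two (d : ℕ) {α : ℝ} (hα : 2 ≤ α) (t : ℕ) :
    spacingMoment d α t ≤ spacingMoment d 2 t := by
  refine Finset.prod_le_prod (fun s _ => by positivity) fun s _ => ?_
  rw [div_le_div_iff₀ (by positivity) (by positivity)]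
  nlinarith [mul_nonneg (Nat.cast_nonneg (α := ℝ) s) (sub_nonneg.2 hα)]

theorem sum_spacingMoment_one_le {d n : ℕ} (hd : 1 ≤ d) (hn : 2 ≤ n) :
    ∑ t ∈ Finset.range n, min 1 (((d : ℝ) + 1) * spacingMoment d 1 t) ≤
      1 + (d + 1) * d * (1 + Real.log n) := by
  obtain ⟨m, rfl⟩ : ∃ m, n = m + 1 := ⟨n - 1, by omega⟩
  have hd' : (0 : ℝ) < d := by exact_mod_cast hd
  -- The term `t = 0` is bounded by `1`; the others are compared with the harmonic sum through `d /
  -- (d + t) ≤ d / t`.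
  rw [Finset.sum_range_succ', add_comm]
  refine add_le_add (min_le_left _ _) ?_
  have hH : ((harmonic m : ℚ) : ℝ) ≤ 1 + Real.log (m + 1 : ℕ) := by
    refine (harmonic_le_one_add_log m).trans ?_
    gcongr
    · exact_mod_cast (by omega : 0 < m)
    · omega
  refine le_trans ?_ (mul_le_mul_of_nonneg_left hH (by positivity))
  rw [harmonic, Rat.cast_sum, Finset.mul_sum]
  refine Finset.sum_le_sum fun t _ => (min_le_right _ _).trans ?_
  rw [spacingMoment_one hd, mul_assoc]
  push_cast
  rw [div_eq_mul_inv]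
  exact mul_le_mul_of_nonneg_left (mul_le_mul_of_nonneg_left
    (inv_anti₀ (by positivity) (by linarith)) hd'.le) (by positivity)

theorem sum_spacingMoment_two_le {d : ℕ} (hd : 1 ≤ d) (n : ℕ) {α : ℝ} (hα : 2 ≤ α) :
    ∑ t ∈ Finset.range n, min 1 (((d : ℝ) + 1) * spacingMoment d α t) ≤
      (d + 1) * (2 * d + 1) := by
  have hd' : (0 : ℝ) < d := by exact_mod_cast hd
  calc ∑ t ∈ Finset.range n, min 1 (((d : ℝ) + 1) * spacingMoment d α t)
      ≤ ∑ t ∈ Finset.range n, ((d : ℝ) + 1) * (2 * d * (2 * d + 1)) *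
          (1 / (2 * d + t) - 1 / (2 * d + (t + 1 : ℕ))) := by
        refine Finset.sum_le_sum fun t _ => (min_le_right _ _).trans ?_
        have h := spacingMoment_le_two d hα t
        rw [spacingMoment_two hd] at h
        push_cast
        rw [mul_assoc, ← add_assoc]
        gcongr
    _ = ((d : ℝ) + 1) * (2 * d * (2 * d + 1)) * (1 / (2 * d) - 1 / (2 * d + n)) := by
        rw [← Finset.mul_sum, Finset.sum_range_sub' (fun t : ℕ => 1 / (2 * (d : ℝ) + t))]
        simp
    _ ≤ ((d : ℝ) + 1) * (2 * d * (2 * d + 1)) * (1 / (2 * d)) := by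
        gcongr
        have : 0 ≤ 1 / (2 * (d : ℝ) + n) := by positivity
        linarith
    _ = (d + 1) * (2 * d + 1) := by field_simp

theorem sum_spacingMoment_le_of_log_le {d n : ℕ} (hd : 1 ≤ d) (hn : 2 ≤ n) (hdn : d < n) {α : ℝ}
    (hα : 6 * Real.log n ≤ α) :
    ∑ t ∈ Finset.range n, min 1 (((d : ℝ) + 1) * spacingMoment d α t) ≤
      6 * d * Real.log n + 2 := by
  have hd' : (1 : ℝ) ≤ d := by exact_mod_cast hd
  have hL := two_thirds_le_log hn
  have hα0 : 0 < α := by linarith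
  have hn0 : (0 : ℝ) < n := by exact_mod_cast (by omega : 0 < n)
  have hdn' : (d : ℝ) + 1 ≤ n := by exact_mod_cast hdn
  -- For `s < T` each factor of the moment is at most `exp (-1 / (3 * d))`, so `T` factors bring it
  -- down to `n ^ (-2)`.
  set T := ⌈6 * d * Real.log n⌉₊ with hT
  have hT1 : (T : ℝ) ≤ 6 * d * Real.log n + 1 := (Nat.ceil_lt_add_one (by positivity)).le
  have hT2 : 6 * d * Real.log n ≤ T := Nat.le_ceil _
  have hM : spacingMoment d α T ≤ Real.exp (-(2 * Real.log n)) := by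
    calc spacingMoment d α T ≤ ∏ s ∈ Finset.range T, Real.exp (-(1 / (3 * d))) := by
          refine Finset.prod_le_prod (fun s _ => by positivity) fun s hs => ?_
          have hs' : (s : ℝ) < 6 * d * Real.log n := Nat.lt_ceil.1 (Finset.mem_range.1 hs)
          -- Hence `(d + 1) * α + s ≤ 3 * d * α`, and the factor is at most `1 - 1 / (3 * d)`. This
          -- is where `6 * log n ≤ α` enters.
          have hsα : (s : ℝ) ≤ d * α := by nlinarith
          refine le_trans ?_ (Real.add_one_le_exp _)
          rw [div_le_iff₀ (by positivity)]
          have : ((d + 1) * α + s) / (3 * d) ≤ α := by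
            rw [div_le_iff₀ (by positivity)]
            nlinarith
          calc (d * α + s : ℝ) = ((d + 1) * α + s) - α := by ring
            _ ≤ ((d + 1) * α + s) - ((d + 1) * α + s) / (3 * d) := by linarith
            _ = _ := by ring
      _ = Real.exp (-(T / (3 * d))) := by
          rw [Finset.prod_const, Finset.card_range, ← Real.exp_nat_mul]
          congr 1
          ring
      _ ≤ _ := by
          rw [Real.exp_le_exp, neg_le_neg_iff, le_div_iff₀ (by positivity)]
          linarith
  have hexp : Real.exp (-(2 * Real.log n)) = 1 / (n : ℝ) ^ 2 := by
    rw [Real.exp_neg, two_mul, Real.exp_add, Real.exp_log hn0, one_div, sq]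
  -- Terms before `T` are at most `1`, later ones at most `(d + 1) / n ^ 2 ≤ 1 / n`; the `1 / n`
  -- contribute `1` in total.
  have hterm : ∀ t ∈ Finset.range n, min 1 (((d : ℝ) + 1) * spacingMoment d α t) ≤
      (if t < T then 1 else 0) + 1 / n := by
    intro t _
    split_ifs with h
    · exact (min_le_left _ _).trans (le_add_of_nonneg_right (by positivity))
    · rw [zero_add]
      refine (min_le_right _ _).trans ?_
      have h1 : spacingMoment d α t ≤ 1 / (n : ℝ) ^ 2 :=
        (spacingMoment_antitone d hα0 (not_lt.1 h)).trans (hM.trans hexp.le)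
      calc ((d : ℝ) + 1) * spacingMoment d α t ≤ n * (1 / (n : ℝ) ^ 2) :=
            mul_le_mul hdn' h1 (spacingMoment_nonneg d hα0 t) hn0.le
        _ = 1 / n := by field_simp
  refine (Finset.sum_le_sum hterm).trans ?_
  rw [Finset.sum_add_distrib, Finset.sum_const, Finset.card_range, nsmul_eq_mul,
    mul_one_div_cancel hn0.ne', Finset.sum_boole]
  have hcard : (((Finset.range n).filter fun t => t < T).card : ℝ) ≤ T := by
    have := Finset.card_le_card
      (show (Finset.range n).filter (fun t => t < T) ⊆ Finset.range T from
        fun t ht => Finset.mem_range.2 (Finset.mem_filter.1 ht).2)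
    rw [Finset.card_range] at this
    exact_mod_cast this
  linarith

/-- If `log n ≤ 6 / c` then `n` is bounded in terms of `c`, and if `n ≤ d` the trivial bound `n`
suffices. Otherwise `c * log n ^ 2 ≥ 6 * log n`. -/
theorem sum_spacingMoment_le_of_log_sq_le {d n : ℕ} (hd : 1 ≤ d) (hn : 2 ≤ n) {c α : ℝ}
    (hc : 0 < c) (hα : c * Real.log n ^ 2 ≤ α) :
    ∑ t ∈ Finset.range n, min 1 (((d : ℝ) + 1) * spacingMoment d α t) ≤
      (9 + 2 * Real.exp (6 / c)) * (d * Real.log n) := by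
  have hd' : (1 : ℝ) ≤ d := by exact_mod_cast hd
  have hL := two_thirds_le_log hn
  have hn0 : (0 : ℝ) < n := by exact_mod_cast (by omega : 0 < n)
  have he := Real.exp_pos (6 / c)
  have hdL : 2 / 3 ≤ d * Real.log n := by nlinarith
  have htriv : ∑ t ∈ Finset.range n, min 1 (((d : ℝ) + 1) * spacingMoment d α t) ≤ n := by
    refine (Finset.sum_le_card_nsmul _ _ 1 fun t _ => min_le_left _ _).trans ?_
    simp
  by_cases h1 : Real.log n ≤ 6 / c
  · have : (n : ℝ) ≤ Real.exp (6 / c) := by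
      rw [← Real.exp_log hn0]
      exact Real.exp_le_exp.2 h1
    nlinarith
  by_cases h2 : n ≤ d
  · have : (n : ℝ) ≤ d := by exact_mod_cast h2
    nlinarith [mul_pos he (show 0 < d * Real.log n by linarith)]
  have h3 : 6 * Real.log n ≤ α := by
    rw [not_le, div_lt_iff₀ hc] at h1
    nlinarith
  have := sum_spacingMoment_le_of_log_le hd hn (not_le.1 h2) h3
  nlinarith [mul_pos he (show 0 < d * Real.log n by linarith)]

end PTF

end

/-! ### Assembling the constants -/

theorem mainTheorem7 :
    (∀ d : ℕ, PTF.PerfectlyLearns d (PTF.sampleAndSearch d)) ∧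
    (∃ C : ℝ, 0 < C ∧ ∀ (d n : ℕ) (a : ℝ), 2 ≤ d → 2 ≤ n → a ≠ 0 →
      PTF.expectedQueries (PTF.sampleAndSearch d) d n 1 a ≤
        ENNReal.ofReal (C * ((d : ℝ) ^ 2 * Real.log d * Real.log n))) ∧
    (∃ C : ℝ, 0 < C ∧ ∀ (d n : ℕ) (α a : ℝ), 1 ≤ d → 2 ≤ n → 2 ≤ α → a ≠ 0 →
      PTF.expectedQueries (PTF.sampleAndSearch d) d n α a ≤
        ENNReal.ofReal (C * ((d : ℝ) ^ 2 * Real.log d + d * Real.log n))) ∧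
    (∀ c : ℝ, 0 < c → ∃ C : ℝ, 0 < C ∧
      ∀ (d n : ℕ) (α a : ℝ), 1 ≤ d → 2 ≤ n → c * Real.log n ^ 2 ≤ α → a ≠ 0 →
        PTF.expectedQueries (PTF.sampleAndSearch d) d n α a ≤
          ENNReal.ofReal (C * (d * Real.log n))) := by
  refine ⟨PTF.perfectlyLearns_sampleAndSearch, ⟨9, by norm_num, ?_⟩, ⟨12, by norm_num, ?_⟩, ?_⟩
  · intro d n a hd hn ha
    refine (PTF.expectedQueries_le (by omega) one_pos ha).trans (ENNReal.ofReal_le_ofReal ?_)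
    have h1 := PTF.sum_spacingMoment_one_le (show 1 ≤ d by omega) hn
    have h2 := PTF.clog_two_le_log hn
    have hL := PTF.two_thirds_le_log hn
    have hD := PTF.two_thirds_le_log hd
    have hd' : (2 : ℝ) ≤ d := by exact_mod_cast hd
    have h3 : (d : ℝ) * Nat.clog 2 n ≤ d * (3 * Real.log n) := by gcongr
    -- The estimate obtained is of order `d ^ 2 * log n`; the factor `log d ≥ 2 / 3` is only
    -- inserted at the end.
    have h4 : ((d : ℝ) + 1) * d ≤ 3 / 2 * (d : ℝ) ^ 2 := by nlinarith
    have h5 : ((d : ℝ) + 1) * d * (1 + Real.log n) ≤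
        3 / 2 * (d : ℝ) ^ 2 * (5 / 2 * Real.log n) :=
      mul_le_mul h4 (by linarith) (by linarith) (by positivity)
    have h6 : (1 : ℝ) ≤ 3 / 8 * ((d : ℝ) ^ 2 * Real.log n) := by nlinarith
    have h7 : (d : ℝ) * (3 * Real.log n) ≤ 3 / 2 * ((d : ℝ) ^ 2 * Real.log n) := by
      nlinarith [mul_nonneg (mul_nonneg (show (0 : ℝ) ≤ d by linarith)
        (show (0 : ℝ) ≤ d - 2 by linarith)) (show 0 ≤ Real.log n by linarith)]
    have h8 : 0 ≤ (d : ℝ) ^ 2 * Real.log n := by positivity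
    have h9 : (d : ℝ) ^ 2 * Real.log n * (2 / 3) ≤ (d : ℝ) ^ 2 * Real.log n * Real.log d :=
      mul_le_mul_of_nonneg_left hD h8
    linarith
  · intro d n α a hd hn hα ha
    refine (PTF.expectedQueries_le hd (by linarith) ha).trans (ENNReal.ofReal_le_ofReal ?_)
    have h1 := PTF.sum_spacingMoment_two_le hd n hα
    have h2 := PTF.clog_two_le_log hn
    have hL := PTF.two_thirds_le_log hn
    have hd' : (1 : ℝ) ≤ d := by exact_mod_cast hd
    have h3 : (d : ℝ) * Nat.clog 2 n ≤ d * (3 * Real.log n) := by gcongr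
    have h4 : ((d : ℝ) + 1) * (2 * d + 1) ≤ 6 * (d : ℝ) ^ 2 := by nlinarith
    -- For `d = 1` the term with `log d` vanishes, and the constant `6` is absorbed by `9 * log n`.
    rcases hd.eq_or_lt with rfl | hd2
    · norm_num at *
      linarith
    · have hD := PTF.two_thirds_le_log (show 2 ≤ d by omega)
      have h5 : (d : ℝ) ^ 2 * (2 / 3) ≤ (d : ℝ) ^ 2 * Real.log d :=
        mul_le_mul_of_nonneg_left hD (by positivity)
      have h6 : 0 ≤ (d : ℝ) * Real.log n := by positivity
      linarith
  · intro c hc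
    refine ⟨12 + 2 * Real.exp (6 / c), by positivity, ?_⟩
    intro d n α a hd hn hα ha
    have hL := PTF.two_thirds_le_log hn
    have hα0 : 0 < α := lt_of_lt_of_le (by positivity) hα
    refine (PTF.expectedQueries_le hd hα0 ha).trans (ENNReal.ofReal_le_ofReal ?_)
    have h1 := PTF.sum_spacingMoment_le_of_log_sq_le hd hn hc hα
    have h2 := PTF.clog_two_le_log hn
    have h3 : (d : ℝ) * Nat.clog 2 n ≤ d * (3 * Real.log n) := by gcongr
    linarith
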